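/- Let $\mathbb{M}^2$ be a normed plane, i.e. a two-dimensional real normed space, with closed discs $B(x,\lambda)=\{y:\|y-x\|\le\lambda\}$ and circles $S(x,\lambda)=\{y:\|y-x\|=\lambda\}$. For $p\neq q$ in $S(x,\lambda)$, a *minimal circular arc of $B(x,\lambda)$ meeting $p$ and $q$* is a simple arc contained in $S(x,\lambda)$ with endpoints $p$ and $q$ that lies in a closed half-plane bounded by the line through $p$ and $q$ whose interior does not contain the center $x$ (so if $p,q$ are opposite points of $S(x,\lambda)$, both half-circles with endpoints $p,q$ are minimal). For a finite set $K\subset\mathbb{M}^2$ let $\mathrm{bh}(K,\lambda)=\bigcap_{K\subset B(x,\lambda)}B(x,\lambda)$ be its $\lambda$-ball hull, let $\lambda_K$ be its circumradius (the smallest radius of a disc containing $K$), and let $\mathrm{diam}(K)$ be its diameter. **Proposition 3.8.** Let $K$ be a finite set with at least two points in a normed plane $\mathbb{M}^2$, and let $\lambda>0$ with $\lambda\ge\lambda_K$. Let $\mathcal{H}$ be the family of all discs $B(x,\lambda)$ that contain $K$ and whose boundary circle $S(x,\lambda)$ contains a minimal circular arc of $B(x,\lambda)$ meeting two distinct points of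 $K$. If $\mathbb{M}^2$ is strictly convex or $\lambda\ge\mathrm{diam}(K)$, then $$\mathrm{bh}(K,\lambda)=\bigcap_{B\in\mathcal{H}}B,$$ and moreover there are finitely many discs $B(x_1,\lambda),\dots,B(x_k,\lambda)$ in $\mathcal{H}$ with $$\mathrm{bh}(K,\lambda)=\bigcap_{i=1}^k B(x_i,\lambda).$$ -/

import Mathlib

open Set Metric

/-- The `lam`-ball hull of `K`: the intersection of all closed balls of radius `lam` that
contain `K`. -/
def ballHull {E : Type*} [NormedAddCommGroup E] (K : Set E) (lam : ℝ) : Set E :=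
  ⋂ x ∈ {x : E | K ⊆ closedBall x lam}, closedBall x lam

/-- The circumradius (Chebyshev radius) of `K`: the infimum of the radii of the closed balls that
contain `K`. -/
noncomputable def circumradius {E : Type*} [NormedAddCommGroup E] (K : Set E) : ℝ :=
  sInf {r : ℝ | 0 ≤ r ∧ ∃ x : E, K ⊆ closedBall x r}

/-- `A` is a piece of the circle with center `x` and radius `lam` with the two distinct endpoints
`p` and `q`, that is, a simple (injectively parametrized) arc in that circle from `p` to `q`. -/
def IsCircularArc {E : Type*} [NormedAddCommGroup E] (x : E) (lam : ℝ) (p q : E)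
    (A : Set E) : Prop :=
  p ≠ q ∧ A ⊆ sphere x lam ∧ ∃ γ : Path p q, Function.Injective γ ∧ range γ = A

/-- `A` is a minimal circular arc of the disc with center `x` and radius `lam` meeting `p` and `q`:
a circular arc with endpoints `p` and `q` that lies on the side of the line through `p` and `q`
opposite to the center `x`. Sides are closed half-planes; when `p` and `q` are opposite points of
the circle, the center is on that line and the condition holds for both half-circles. -/
def IsMinimalArc {E : Type*} [NormedAddCommGroup E] [NormedSpace ℝ E] (x : E) (lam : ℝ) (p q : E)
    (A : Set E) : Prop :=
  IsCircularArc x lam p q A ∧ ∀ a ∈ A, (affineSpan ℝ {p, q}).WOppSide x a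

/-- The centers of the discs of radius `lam` that contain `K` and whose boundary circle contains
a minimal circular arc meeting two points of `K`. -/
def arcDiscCenters {E : Type*} [NormedAddCommGroup E] [NormedSpace ℝ E] (K : Set E) (lam : ℝ) :
    Set E :=
  {x : E | K ⊆ closedBall x lam ∧ ∃ p ∈ K, ∃ q ∈ K, ∃ A : Set E, IsMinimalArc x lam p q A}

/-! Since `y ∈ B(x, lam)` iff `x ∈ B(y, lam)`, both claims concern centers. Let `C` be the compact
convex set of centers of discs containing `K`, and `H ⊆ C` the arc disc centers. Minimal arcs always
exist, so `x ∈ H` just means that two points of `K` lie on the circle around `x`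
(`mem_arcDiscCenters_iff`).

The first claim says that a disc around `y` containing `H` contains `C`
(`norm_sub_le_of_forall_arcDiscCenters`). Otherwise a point `x` of `C` farthest from `y` has exactly
one point `p` of `K` on its circle, and a functional norming `x - y` supports `B(p, lam)` at `x`.
Following the circle around `p` from `x` until it leaves another disc around a point of `K` gives
points of `H`. These lie in `B(y, lam)`, which `not_exit_bound` refutes.

For finiteness, `H` lies in the convex hull of finitely many of its points
(`hasFiniteHull_arcDiscCenters`), and a disc around `y` containing those contains `H`. The key is
that two circles of equal radius meet, on each side of the line through their centers, in a subset
of two lines (`norming_eq_of_mem_inter`). -/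

section NormedPlane

variable {E : Type*} [NormedAddCommGroup E] [NormedSpace ℝ E]

/-! ### Norming functionals and kernels of functionals in dimension two. -/

theorem exists_norming_functional {x : E} (hx : x ≠ 0) :
    ∃ f : E →L[ℝ] ℝ, f x = ‖x‖ ∧ ∀ y, f y ≤ ‖y‖ := by
  obtain ⟨g, hg, hgx⟩ := exists_dual_vector ℝ x (norm_ne_zero_iff.2 hx)
  refine ⟨g, by simpa using hgx, fun y => ?_⟩
  have := g.le_opNorm y
  rw [hg, one_mul] at this
  exact (le_abs_self _).trans this

theorem exists_span_ker_of_finrank_eq_two (hE : Module.finrank ℝ E = 2) (f : E →L[ℝ] ℝ)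
    {v : E} (hv : f v ≠ 0) :
    ∃ e : E, e ≠ 0 ∧ f e = 0 ∧ ∀ z, f z = 0 → ∃ t : ℝ, z = t • e := by
  have : FiniteDimensional ℝ E := Module.finite_of_finrank_eq_succ hE
  have hf : (f : E →ₗ[ℝ] ℝ) ≠ 0 := fun h => hv (by simpa using congrArg (fun g => g v) h)
  have h1 : Module.finrank ℝ (LinearMap.ker (f : E →ₗ[ℝ] ℝ)) = 1 := by
    have := Module.Dual.finrank_ker_add_one_of_ne_zero (f := (f : E →ₗ[ℝ] ℝ)) hf
    omega
  obtain ⟨e, he, hspan⟩ := finrank_eq_one_iff'.1 h1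
  refine ⟨e, by simpa using he, e.2, fun z hz => ?_⟩
  obtain ⟨c, hc⟩ := hspan ⟨z, by simpa using hz⟩
  exact ⟨c, by simpa using (congrArg Subtype.val hc).symm⟩

theorem exists_functional_ker_span (hE : Module.finrank ℝ E = 2) {w : E} (hw : w ≠ 0) :
    ∃ l : E →L[ℝ] ℝ, (∃ v, l v ≠ 0) ∧ l w = 0 ∧ ∀ z, l z = 0 → ∃ t : ℝ, z = t • w := by
  have : FiniteDimensional ℝ E := Module.finite_of_finrank_eq_succ hE
  have hlt : Submodule.span ℝ {w} < ⊤ := by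
    refine lt_top_iff_ne_top.2 fun h => ?_
    have h1 := finrank_span_singleton (K := ℝ) hw
    rw [h, finrank_top, hE] at h1
    omega
  obtain ⟨g, hg, hle⟩ := Submodule.exists_le_ker_of_lt_top _ hlt
  obtain ⟨v, hv⟩ : ∃ v, g v ≠ 0 := by
    by_contra! h
    exact hg (LinearMap.ext h)
  have hgw : g w = 0 := hle (Submodule.mem_span_singleton_self w)
  refine ⟨LinearMap.toContinuousLinearMap g, ⟨v, by simpa using hv⟩, by simpa using hgw, ?_⟩
  obtain ⟨e, he, -, hspan⟩ :=
    exists_span_ker_of_finrank_eq_two hE (LinearMap.toContinuousLinearMap g) (v := v)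
      (by simpa using hv)
  obtain ⟨c, hc⟩ := hspan w (by simpa using hgw)
  have hc0 : c ≠ 0 := by
    rintro rfl
    exact hw (by simpa using hc)
  intro z hz
  obtain ⟨t, ht⟩ := hspan z hz
  refine ⟨t / c, ?_⟩
  rw [ht, hc, smul_smul, div_mul_cancel₀ _ hc0]

/-! ### Existence of minimal arcs -/

theorem norm_smul_div_norm {lam : ℝ} (hlam : 0 < lam) {c : E} (hc : c ≠ 0) :
    ‖(lam / ‖c‖) • c‖ = lam := by
  have : 0 < ‖c‖ := norm_pos_iff.2 hc
  rw [norm_smul, Real.norm_of_nonneg (by positivity)]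
  field_simp

/-- The radial projection to a circle of a curve that meets each ray from the center at most
once is a circular arc. -/
theorem isCircularArc_radial {x p q : E} {lam : ℝ} (hlam : 0 < lam) (hp : p ∈ sphere x lam)
    (hq : q ∈ sphere x lam) (hpq : p ≠ q) (c : ℝ → E) (hc : Continuous c)
    (hc0 : c 0 = p - x) (hc1 : c 1 = q - x) (hne : ∀ t ∈ Icc (0 : ℝ) 1, c t ≠ 0)
    (hinj : ∀ s ∈ Icc (0 : ℝ) 1, ∀ t ∈ Icc (0 : ℝ) 1, ∀ k : ℝ, 0 < k → c s = k • c t → s = t) :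
    IsCircularArc x lam p q
      (range fun t : unitInterval => x + (lam / ‖c t‖) • c t) := by
  have hnorm : ∀ t : unitInterval, 0 < ‖c t‖ := fun t => norm_pos_iff.2 (hne t t.2)
  have hpn : ‖p - x‖ = lam := mem_sphere_iff_norm.1 hp
  have hqn : ‖q - x‖ = lam := mem_sphere_iff_norm.1 hq
  refine ⟨hpq, ?_, ⟨⟨⟨fun t : unitInterval => x + (lam / ‖c t‖) • c t, ?_⟩, ?_, ?_⟩, ?_, rfl⟩⟩
  · rintro _ ⟨t, rfl⟩
    rw [mem_sphere_iff_norm, add_sub_cancel_left]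
    exact norm_smul_div_norm hlam (hne t t.2)
  · have hct : Continuous fun t : unitInterval => c t := hc.comp continuous_subtype_val
    exact continuous_const.add
      ((continuous_const.div hct.norm fun t => (hnorm t).ne').smul hct)
  · simp [hc0, hpn, hlam.ne']
  · simp [hc1, hqn, hlam.ne']
  · intro s t hst
    have h1 : (lam / ‖c s‖) • c s = (lam / ‖c t‖) • c t := add_left_cancel hst
    refine Subtype.ext (hinj s s.2 t t.2 (‖c s‖ / ‖c t‖) (div_pos (hnorm s) (hnorm t)) ?_)
    have h2 := congrArg (fun z => (‖c s‖ / lam) • z) h1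
    simp only [smul_smul] at h2
    have hs := (hnorm s).ne'
    have ht := (hnorm t).ne'
    have e1 : ‖c s‖ / lam * (lam / ‖c s‖) = 1 := by field_simp
    have e2 : ‖c s‖ / lam * (lam / ‖c t‖) = ‖c s‖ / ‖c t‖ := by field_simp
    rwa [e1, e2, one_smul] at h2

theorem linearIndependent_pair_of_norm_eq {a b : E} (hab : ‖a‖ = ‖b‖) (ha : a ≠ 0)
    (h1 : a ≠ b) (h2 : b ≠ -a) {s t : ℝ} (hst : s • a + t • b = 0) : s = 0 ∧ t = 0 := by
  by_cases ht : t = 0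
  · subst ht
    simpa [ha] using hst
  · exfalso
    have hb : b = (-s / t) • a := by
      have h3 : t • b = (-s) • a := by
        rw [neg_smul]
        exact eq_neg_of_add_eq_zero_right hst
      rw [div_eq_inv_mul, mul_smul, ← h3, smul_smul, inv_mul_cancel₀ ht, one_smul]
    have h4 := hab
    rw [hb, norm_smul] at h4
    have h5 : ‖-s / t‖ = 1 := by
      exact mul_right_cancel₀ (norm_ne_zero_iff.2 ha) (by rw [← h4, one_mul])
    rcases eq_or_eq_neg_of_abs_eq h5 with h | h
    · exact h1 (by rw [hb, h, one_smul])
    · exact h2 (by rw [hb, h, neg_smul, one_smul])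

/-- The curve from `v` to `-v` through the direction of `e`. -/
theorem halfTurn_injOn_rays {v e : E} (hve : ∀ s t : ℝ, s • v + t • e = 0 → s = 0 ∧ t = 0)
    {s t k : ℝ} (hs : s ∈ Icc (0 : ℝ) 1) (ht : t ∈ Icc (0 : ℝ) 1) (hk : 0 < k)
    (h : (1 - 2 * s) • v + (s * (1 - s)) • e = k • ((1 - 2 * t) • v + (t * (1 - t)) • e)) :
    s = t := by
  obtain ⟨h1, h2⟩ := hve (1 - 2 * s - k * (1 - 2 * t)) (s * (1 - s) - k * (t * (1 - t))) (by
    linear_combination (norm := module) h)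
  -- The determinant of the two coordinate vectors, which vanishes on a common ray, eliminates `k`.
  have h3 : (t - s) * ((1 - t) * (1 - s) + s * t) = 0 := by
    linear_combination (t * (1 - t)) * h1 - (1 - 2 * t) * h2
  rcases mul_eq_zero.1 h3 with h4 | h4
  · linarith
  · exfalso
    have h5 : 0 ≤ (1 - t) * (1 - s) := mul_nonneg (by linarith [ht.2]) (by linarith [hs.2])
    have h6 : 0 ≤ s * t := mul_nonneg hs.1 ht.1
    have h7 : s * t = 0 := by linarith
    have h8 : (1 - t) * (1 - s) = 0 := by linarith
    rcases mul_eq_zero.1 h7 with h9 | h9 <;> rcases mul_eq_zero.1 h8 with h10 | h10 <;>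
      nlinarith

theorem halfTurn_ne_zero {v e : E} (hve : ∀ s t : ℝ, s • v + t • e = 0 → s = 0 ∧ t = 0) (t : ℝ) :
    (1 - 2 * t) • v + (t * (1 - t)) • e ≠ 0 := by
  intro h
  obtain ⟨h1, h2⟩ := hve _ _ h
  nlinarith

/-- Project the chord radially from the center; for opposite points the chord hits the center, so it
is bent sideways through a direction `e` off the line. -/
theorem exists_isMinimalArc (hE : Module.finrank ℝ E = 2) {x p q : E} {lam : ℝ} (hlam : 0 < lam)
    (hp : p ∈ sphere x lam) (hq : q ∈ sphere x lam) (hpq : p ≠ q) :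
    ∃ A : Set E, IsMinimalArc x lam p q A := by
  have hpn : ‖p - x‖ = lam := mem_sphere_iff_norm.1 hp
  have hqn : ‖q - x‖ = lam := mem_sphere_iff_norm.1 hq
  have hp0 : p - x ≠ 0 := norm_pos_iff.1 (hpn ▸ hlam)
  by_cases hopp : q - x = -(p - x)
  · obtain ⟨l, ⟨e, he⟩, hl, -⟩ := exists_functional_ker_span hE hp0
    have hve : ∀ s t : ℝ, s • (p - x) + t • e = 0 → s = 0 ∧ t = 0 := by
      intro s t h
      have ht : t = 0 := by
        have := congrArg l h
        simpa [-map_sub, hl, he] using this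
      subst ht
      simpa [hp0] using h
    refine ⟨_, isCircularArc_radial hlam hp hq hpq
      (fun t => (1 - 2 * t) • (p - x) + (t * (1 - t)) • e) (by fun_prop) (by simp) ?_
      (fun t _ => halfTurn_ne_zero hve t)
      (fun s hs t ht k hk h => halfTurn_injOn_rays hve hs ht hk h), ?_⟩
    · simp only [hopp]
      norm_num
    · intro a _
      refine AffineSubspace.wOppSide_of_left_mem _ ?_
      have hx : x = AffineMap.lineMap p q (1 / 2 : ℝ) := by
        have hq' : q = x + x - p := by linear_combination (norm := module) hopp
        rw [AffineMap.lineMap_apply, hq', vsub_eq_sub, vadd_eq_add]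
        module
      rw [hx]
      exact AffineMap.lineMap_mem_affineSpan_pair _ _ _
  · have hind : ∀ s t : ℝ, s • (p - x) + t • (q - x) = 0 → s = 0 ∧ t = 0 := fun s t =>
      linearIndependent_pair_of_norm_eq (by rw [hpn, hqn]) hp0
        (fun h => hpq (sub_left_injective h)) hopp
    have hne : ∀ t : ℝ, (1 - t) • (p - x) + t • (q - x) ≠ 0 := by
      intro t h
      obtain ⟨h1, h2⟩ := hind _ _ h
      linarith
    refine ⟨_, isCircularArc_radial hlam hp hq hpq
      (fun t => (1 - t) • (p - x) + t • (q - x)) (by fun_prop) (by simp) (by simp)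
      (fun t _ => hne t) ?_, ?_⟩
    · intro s _ t _ k _ h
      obtain ⟨h1, h2⟩ := hind (1 - s - k * (1 - t)) (s - k * t) (by
        linear_combination (norm := module) h)
      have hk : k = 1 := by linarith
      subst hk
      linarith
    · rintro _ ⟨t, rfl⟩
      set m : E := (1 - (t : ℝ)) • (p - x) + (t : ℝ) • (q - x) with hm
      have hm0 : 0 < ‖m‖ := norm_pos_iff.2 (hne t)
      have hmle : ‖m‖ ≤ lam := by
        have h0 : (0 : ℝ) ≤ t := t.2.1
        have h1 : (0 : ℝ) ≤ 1 - t := by linarith [t.2.2]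
        calc ‖m‖ ≤ ‖(1 - (t : ℝ)) • (p - x)‖ + ‖(t : ℝ) • (q - x)‖ := norm_add_le _ _
          _ = (1 - t) * lam + t * lam := by
            rw [norm_smul, norm_smul, hpn, hqn, Real.norm_of_nonneg h0, Real.norm_of_nonneg h1]
          _ = lam := by ring
      have hmem : x + m ∈ affineSpan ℝ {p, q} := by
        have : x + m = AffineMap.lineMap p q (t : ℝ) := by
          rw [AffineMap.lineMap_apply, vsub_eq_sub, vadd_eq_add, hm]
          module
        rw [this]
        exact AffineMap.lineMap_mem_affineSpan_pair _ _ _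
      -- The chord point `x + m` lies between `x` and its projection, since `‖m‖ ≤ lam`.
      refine ⟨x + m, hmem, x + m, hmem, ?_⟩
      have e1 : x -ᵥ (x + m) = -m := by simp
      have e2 : x + m -ᵥ (x + (lam / ‖m‖) • m) = (lam / ‖m‖ - 1) • (-m) := by
        rw [vsub_eq_sub]
        module
      rw [e1, e2]
      refine SameRay.sameRay_nonneg_smul_right _ ?_
      rw [sub_nonneg, one_le_div hm0]
      exact hmle

theorem mem_arcDiscCenters_iff (hE : Module.finrank ℝ E = 2) {K : Set E} {lam : ℝ}
    (hlam : 0 < lam) {x : E} :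
    x ∈ arcDiscCenters K lam ↔ (∀ k ∈ K, ‖x - k‖ ≤ lam) ∧
      ∃ p ∈ K, ∃ q ∈ K, p ≠ q ∧ ‖x - p‖ = lam ∧ ‖x - q‖ = lam := by
  constructor
  · rintro ⟨hKx, p, hp, q, hq, A, ⟨hpq, hA, γ, -, rfl⟩, -⟩
    refine ⟨fun k hk => ?_, p, hp, q, hq, hpq, ?_, ?_⟩
    · exact mem_closedBall_iff_norm'.1 (hKx hk)
    · exact (norm_sub_rev _ _).trans (mem_sphere_iff_norm.1 (hA ⟨0, γ.source⟩))
    · exact (norm_sub_rev _ _).trans (mem_sphere_iff_norm.1 (hA ⟨1, γ.target⟩))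
  · rintro ⟨hKx, p, hp, q, hq, hpq, hxp, hxq⟩
    exact ⟨fun k hk => mem_closedBall_iff_norm'.2 (hKx k hk), p, hp, q, hq,
      exists_isMinimalArc hE hlam (mem_sphere_iff_norm.2 ((norm_sub_rev _ _).trans hxp))
        (mem_sphere_iff_norm.2 ((norm_sub_rev _ _).trans hxq)) hpq⟩

/-! ### Sets contained in the convex hull of finitely many of their points -/

/-- `G` lies in the convex hull of a finite subset of `G`. -/
def HasFiniteHull (G : Set E) : Prop :=
  ∃ F : Set E, F.Finite ∧ F ⊆ G ∧ G ⊆ convexHull ℝ F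

theorem HasFiniteHull.union {G G' : Set E} (h : HasFiniteHull G) (h' : HasFiniteHull G') :
    HasFiniteHull (G ∪ G') := by
  obtain ⟨F, hF, hFG, hGF⟩ := h
  obtain ⟨F', hF', hFG', hGF'⟩ := h'
  exact ⟨F ∪ F', hF.union hF', union_subset_union hFG hFG',
    union_subset (hGF.trans (convexHull_mono subset_union_left))
      (hGF'.trans (convexHull_mono subset_union_right))⟩

theorem HasFiniteHull.biUnion {ι : Type*} {s : Set ι} (hs : s.Finite) {G : ι → Set E}
    (h : ∀ i ∈ s, HasFiniteHull (G i)) : HasFiniteHull (⋃ i ∈ s, G i) := by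
  induction s, hs using Set.Finite.induction_on with
  | empty => exact ⟨∅, by simp⟩
  | insert _ _ ih =>
    rw [biUnion_insert]
    exact (h _ (mem_insert _ _)).union (ih fun i hi => h i (mem_insert_of_mem _ hi))

theorem hasFiniteHull_of_subset_line (hE : Module.finrank ℝ E = 2) {G : Set E} (hG : IsCompact G)
    (f : E →L[ℝ] ℝ) {v : E} (hv : f v ≠ 0) {c : ℝ} (hc : ∀ g ∈ G, f g = c) :
    HasFiniteHull G := by
  rcases G.eq_empty_or_nonempty with rfl | hne
  · exact ⟨∅, by simp⟩
  obtain ⟨e, he, -, hspan⟩ := exists_span_ker_of_finrank_eq_two hE f hv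
  obtain ⟨g, hge, -⟩ := exists_norming_functional he
  obtain ⟨a, ha, hamin⟩ := hG.exists_isMinOn hne g.continuous.continuousOn
  obtain ⟨b, hb, hbmax⟩ := hG.exists_isMaxOn hne g.continuous.continuousOn
  refine ⟨{a, b}, by simp, by simp [insert_subset_iff, ha, hb], fun z hz => ?_⟩
  rw [convexHull_pair]
  have hpos : 0 < g e := by rw [hge]; exact norm_pos_iff.2 he
  obtain ⟨k, hk⟩ := hspan (z - a) (by rw [map_sub, hc z hz, hc a ha, sub_self])
  obtain ⟨m, hm⟩ := hspan (b - a) (by rw [map_sub, hc b hb, hc a ha, sub_self])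
  have h1 : g a ≤ g z := hamin hz
  have h2 : g z ≤ g b := hbmax hz
  have hk' : g z - g a = k * g e := by simpa using congrArg g hk
  have hm' : g b - g a = m * g e := by simpa using congrArg g hm
  have hk0 : 0 ≤ k := by nlinarith
  have hkm : k ≤ m := by nlinarith
  rw [segment_eq_image']
  rcases eq_or_lt_of_le (hk0.trans hkm) with hm0 | hm0
  · have hk00 : k = 0 := by linarith
    exact ⟨0, by simp, by simp only [zero_smul, add_zero]; rw [hk00, zero_smul] at hk
                          exact (sub_eq_zero.1 hk).symm⟩
  · refine ⟨k / m, ⟨by positivity, (div_le_one hm0).2 hkm⟩, ?_⟩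
    simp only
    rw [hm, smul_smul, div_mul_cancel₀ _ hm0.ne', ← hk, add_sub_cancel]

/-! ### The intersection of two circles of the same radius -/

/-- The disc contains `u'`, `u' + w` and their negatives. A point of the segment from `u'` to `-u' -
w` lies on the line through `u` parallel to `w`; the functionals `f` and `g`, norming `u` and `u +
w`, force it to be `u`. Hence `f` is maximal along that segment. -/
theorem norming_eq_of_mem_inter {lam : ℝ} {w u u' : E}
    (l : E →L[ℝ] ℝ) (hlw : l w = 0) (hspan : ∀ z, l z = 0 → ∃ t : ℝ, z = t • w)
    (hu : ‖u‖ = lam) (huw : ‖u + w‖ = lam) (hu' : ‖u'‖ = lam) (huw' : ‖u' + w‖ = lam)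
    (h0 : 0 ≤ l u) (hlt : l u < l u') (hlam : 0 < lam)
    {f : E →L[ℝ] ℝ} (hfu : f u = lam) (hf : ∀ y, f y ≤ ‖y‖) : f u' = lam := by
  obtain ⟨g, hgu, hg⟩ := exists_norming_functional (x := u + w)
    (norm_pos_iff.1 (huw ▸ hlam))
  rw [huw] at hgu
  have hpos : 0 < l u' := h0.trans_lt hlt
  obtain ⟨j, hj⟩ := hspan (l u' • u - l u • u') (by simp; ring)
  have hfw : f w < 0 := by
    have h1 := hf (u + w)
    rw [huw, map_add, hfu] at h1
    refine lt_of_le_of_ne (by linarith) fun hw => ?_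
    have h2 := congrArg f hj
    simp only [map_sub, map_smul, smul_eq_mul, hfu, hw, mul_zero] at h2
    have h3 := hf u'
    rw [hu'] at h3
    nlinarith
  have hgw : 0 < g w := by
    have h1 := hg u
    rw [map_add] at hgu
    refine lt_of_le_of_ne (by linarith) fun hw => ?_
    have h2 := congrArg g hj
    simp only [map_sub, map_smul, smul_eq_mul, ← hw, mul_zero] at h2
    have h3 := hg (u' + w)
    rw [huw', map_add] at h3
    nlinarith
  -- This `r` makes `l` of `r • u' + (1 - r) • (-u' - w)` equal to `l u`.
  obtain ⟨r, hr⟩ : ∃ r : ℝ, r * (2 * l u') = l u + l u' :=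
    ⟨(l u + l u') / (2 * l u'), by field_simp⟩
  have hr0 : 0 < r := by nlinarith
  have hr1 : r < 1 := by nlinarith
  obtain ⟨k, hk⟩ := hspan (r • u' + (1 - r) • (-u' - w) - u) (by
    simp [hlw]
    linarith)
  have hfk := congrArg f hk
  have hgk := congrArg g hk
  simp only [map_sub, map_add, map_smul, smul_eq_mul, map_neg, hfu] at hfk hgk hgu
  have f1 := hf u'
  have f2 := hf (-u' - w)
  have g1 := hg (u' + w)
  have g2 := hg (-u')
  have e1 : ‖-u' - w‖ = lam := by rw [← huw', ← norm_neg]; congr 1; abel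
  rw [e1] at f2
  rw [hu'] at f1
  rw [huw'] at g1
  rw [norm_neg, hu'] at g2
  simp only [map_sub, map_add, map_neg] at f2 g1 g2
  have hk0 : 0 ≤ k := by
    have : k * f w ≤ 0 := by nlinarith
    by_contra! hneg
    nlinarith
  have hk1 : k ≤ 0 := by
    have : k * g w ≤ 0 := by nlinarith
    by_contra! hneg
    nlinarith
  have hk2 : k = 0 := le_antisymm hk1 hk0
  subst hk2
  nlinarith

theorem hasFiniteHull_of_subset_inter_halfPlane (hE : Module.finrank ℝ E = 2) {lam : ℝ}
    (hlam : 0 < lam) {p q : E} (l : E →L[ℝ] ℝ) {v : E} (hv : l v ≠ 0)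
    (hlw : l (p - q) = 0) (hspan : ∀ z, l z = 0 → ∃ t : ℝ, z = t • (p - q)) {G : Set E}
    (hG : IsCompact G) (hGp : ∀ x ∈ G, ‖x - p‖ = lam) (hGq : ∀ x ∈ G, ‖x - q‖ = lam)
    (hGl : ∀ x ∈ G, 0 ≤ l (x - p)) : HasFiniteHull G := by
  rcases G.eq_empty_or_nonempty with rfl | hne
  · exact ⟨∅, by simp⟩
  obtain ⟨a, ha, hmin⟩ := hG.exists_isMinOn hne l.continuous.continuousOn
  have ha0 : a - p ≠ 0 := norm_pos_iff.1 (hGp a ha ▸ hlam)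
  obtain ⟨f, hfa, hf⟩ := exists_norming_functional ha0
  rw [hGp a ha] at hfa
  -- Points strictly above the lowest point `a` all lie on the supporting line of the circle at `a`.
  have hsplit : G = (G ∩ {x | l x = l a}) ∪ (G ∩ {x | f x = lam + f p}) := by
    refine Subset.antisymm (fun x hx => ?_) (union_subset inter_subset_left inter_subset_left)
    rcases eq_or_lt_of_le (show l a ≤ l x from hmin hx) with h | h
    · exact Or.inl ⟨hx, h.symm⟩
    · refine Or.inr ⟨hx, ?_⟩
      have hq : ∀ y ∈ G, ‖y - p + (p - q)‖ = lam := fun y hy => by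
        rw [sub_add_sub_cancel]
        exact hGq y hy
      have := norming_eq_of_mem_inter l hlw hspan (hGp a ha) (hq a ha) (hGp x hx) (hq x hx)
        (hGl a ha) (by simpa using h) hlam hfa hf
      rw [map_sub] at this
      simp only [mem_ofPred_eq]
      linarith
  rw [hsplit]
  refine HasFiniteHull.union
    (hasFiniteHull_of_subset_line hE
      (hG.inter_right (isClosed_eq l.continuous continuous_const)) l hv fun g hg => hg.2)
    (hasFiniteHull_of_subset_line hE
      (hG.inter_right (isClosed_eq f.continuous continuous_const)) f (v := a - p) ?_
      fun g hg => hg.2)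
  rw [hfa]
  exact hlam.ne'

theorem hasFiniteHull_of_subset_inter (hE : Module.finrank ℝ E = 2) {lam : ℝ}
    (hlam : 0 < lam) {p q : E} (hpq : p ≠ q) {G : Set E} (hG : IsCompact G)
    (hGp : ∀ x ∈ G, ‖x - p‖ = lam) (hGq : ∀ x ∈ G, ‖x - q‖ = lam) : HasFiniteHull G := by
  obtain ⟨l, ⟨v, hv⟩, hlw, hspan⟩ := exists_functional_ker_span hE (sub_ne_zero.2 hpq)
  have hcont : Continuous fun x => l (x - p) := by fun_prop
  have hsplit : G = (G ∩ {x | 0 ≤ l (x - p)}) ∪ (G ∩ {x | l (x - p) ≤ 0}) := by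
    rw [← inter_union_distrib_left, eq_comm, inter_eq_left]
    exact fun x _ => le_total 0 (l (x - p))
  rw [hsplit]
  refine HasFiniteHull.union
    (hasFiniteHull_of_subset_inter_halfPlane hE hlam l hv hlw hspan
      (hG.inter_right (isClosed_le continuous_const hcont)) (fun x hx => hGp x hx.1)
      (fun x hx => hGq x hx.1) fun x hx => hx.2)
    (hasFiniteHull_of_subset_inter_halfPlane hE hlam (-l) (v := v) (by simpa using hv)
      (by simpa [-map_sub] using hlw) (fun z hz => hspan z (by simpa using hz))
      (hG.inter_right (isClosed_le hcont continuous_const)) (fun x hx => hGp x hx.1)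
      (fun x hx => hGq x hx.1) fun x hx => ?_)
  have := hx.2
  simp only [mem_ofPred_eq] at this
  rw [neg_apply]
  linarith

/-! ### Compactness of the set of centers and the finite hull of the arc disc centers. -/

theorem isCompact_ballCenters (hE : Module.finrank ℝ E = 2) {K : Set E} (hK : K.Nonempty)
    (lam : ℝ) : IsCompact {x : E | ∀ k ∈ K, ‖x - k‖ ≤ lam} := by
  have : FiniteDimensional ℝ E := Module.finite_of_finrank_eq_succ hE
  have : ProperSpace E := FiniteDimensional.proper_real E
  obtain ⟨k, hk⟩ := hK
  refine (isCompact_closedBall k lam).of_isClosed_subset ?_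
    fun x hx => mem_closedBall_iff_norm.2 (hx k hk)
  simp only [ofPred_forall]
  exact isClosed_iInter fun k => isClosed_iInter fun _ =>
    isClosed_le (by fun_prop) continuous_const

theorem hasFiniteHull_arcDiscCenters (hE : Module.finrank ℝ E = 2) {K : Set E} (hfin : K.Finite)
    (hK : K.Nonempty) {lam : ℝ} (hlam : 0 < lam) : HasFiniteHull (arcDiscCenters K lam) := by
  have hU : arcDiscCenters K lam = ⋃ pq ∈ K.offDiag,
      ({x : E | ∀ k ∈ K, ‖x - k‖ ≤ lam} ∩ {x | ‖x - pq.1‖ = lam} ∩ {x | ‖x - pq.2‖ = lam}) := by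
    ext x
    rw [mem_arcDiscCenters_iff hE hlam]
    simp only [mem_iUnion, mem_offDiag, mem_inter_iff, mem_ofPred_eq, Prod.exists, exists_prop]
    constructor
    · rintro ⟨h, p, hp, q, hq, hpq, h1, h2⟩
      exact ⟨p, q, ⟨hp, hq, hpq⟩, ⟨h, h1⟩, h2⟩
    · rintro ⟨p, q, ⟨hp, hq, hpq⟩, ⟨h, h1⟩, h2⟩
      exact ⟨h, p, hp, q, hq, hpq, h1, h2⟩
  rw [hU]
  refine HasFiniteHull.biUnion hfin.offDiag fun pq hpq => ?_
  refine hasFiniteHull_of_subset_inter hE hlam (p := pq.1) (q := pq.2) hpq.2.2 ?_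
    (fun x hx => hx.1.2) fun x hx => hx.2
  exact ((isCompact_ballCenters hE hK lam).inter_right
    (isClosed_eq (by fun_prop) continuous_const)).inter_right
    (isClosed_eq (by fun_prop) continuous_const)

/-! ### Discs containing all arc disc centers -/

/-- On each side of the line through `0` and `v`, the circle of radius `lam` around `0` leaves the
intersection of its translates by `-w`, `w ∈ W`, when `v` lies inside all of them. -/
theorem exists_first_exit {lam : ℝ} (hlam : 0 < lam) {v e : E} {W : Finset E}
    (hW : W.Nonempty) (hv : ‖v‖ = lam) (hvW : ∀ w ∈ W, ‖v + w‖ < lam)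
    (hve : ∀ s t : ℝ, s • v + t • e = 0 → s = 0 ∧ t = 0) :
    ∃ a b : ℝ, 0 < b ∧ ‖a • v + b • e‖ = lam ∧ (∀ w ∈ W, ‖a • v + b • e + w‖ ≤ lam) ∧
      ∃ w ∈ W, ‖a • v + b • e + w‖ = lam := by
  set c : ℝ → E := fun t => (1 - 2 * t) • v + (t * (1 - t)) • e with hc
  have hc0 : ∀ t, c t ≠ 0 := halfTurn_ne_zero hve
  have hcc : Continuous c := by fun_prop
  set γ : ℝ → E := fun t => (lam / ‖c t‖) • c t with hγ
  have hγc : Continuous γ :=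
    (continuous_const.div hcc.norm fun t => norm_ne_zero_iff.2 (hc0 t)).smul hcc
  have hγ0 : γ 0 = v := by simp [hγ, hc, hv, hlam.ne']
  have hγ1 : γ 1 = -v := by
    have : c 1 = -v := by simp only [hc]; norm_num
    simp [hγ, this, hv, hlam.ne']
  set g : ℝ → ℝ := fun t => W.sup' hW fun w => ‖γ t + w‖ with hg
  have hgc : Continuous g := Continuous.finset_sup'_apply hW fun w _ => by fun_prop
  have hg0 : g 0 < lam := by
    simp only [hg, hγ0, Finset.sup'_lt_iff]
    exact hvW
  -- `v + w` and `-v + w` are `2 * lam` apart, and the first has norm below `lam`.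
  have hg1 : lam < g 1 := by
    obtain ⟨w, hw⟩ := hW
    refine (Finset.lt_sup'_iff _).2 ⟨w, hw, ?_⟩
    rw [hγ1]
    have h1 : ‖(v + w) - (-v + w)‖ ≤ ‖v + w‖ + ‖-v + w‖ := norm_sub_le _ _
    have h2 : (v + w) - (-v + w) = (2 : ℝ) • v := by module
    rw [h2, norm_smul, hv, Real.norm_of_nonneg (by norm_num)] at h1
    linarith [hvW w hw]
  obtain ⟨t, ht, hgt⟩ := intermediate_value_Icc (zero_le_one' ℝ) hgc.continuousOn
    ⟨hg0.le, hg1.le⟩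
  have ht0 : t ≠ 0 := by rintro rfl; linarith
  have ht1 : t ≠ 1 := by rintro rfl; linarith
  have ht0' : 0 < t := lt_of_le_of_ne ht.1 (Ne.symm ht0)
  have ht1' : 0 < 1 - t := sub_pos.2 (lt_of_le_of_ne ht.2 ht1)
  have hn : 0 < ‖c t‖ := norm_pos_iff.2 (hc0 t)
  have hγt : γ t = (lam / ‖c t‖ * (1 - 2 * t)) • v + (lam / ‖c t‖ * (t * (1 - t))) • e := by
    simp only [hγ]
    rw [mul_smul, mul_smul, ← smul_add]
  refine ⟨lam / ‖c t‖ * (1 - 2 * t), lam / ‖c t‖ * (t * (1 - t)), by positivity, ?_⟩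
  rw [← hγt]
  refine ⟨norm_smul_div_norm hlam (hc0 t), fun w hw => ?_, ?_⟩
  · rw [← hgt]
    exact Finset.le_sup' (fun w => ‖γ t + w‖) hw
  · obtain ⟨w, hw, hwe⟩ := Finset.exists_mem_eq_sup' hW fun w => ‖γ t + w‖
    exact ⟨w, hw, hwe.symm.trans hgt⟩

/-- The first exit points detect every displacement `z` increasing a functional that supports the
disc at `v`, unless all translations are opposite to `z`. -/
theorem exists_neg_smul_of_exit_bound (hE : Module.finrank ℝ E = 2) {lam : ℝ} (hlam : 0 < lam)
    {v z : E} {W : Finset E} (hv : ‖v‖ = lam) (hvW : ∀ w ∈ W, ‖v + w‖ < lam)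
    {f : E →L[ℝ] ℝ} (hf : ∀ y, f y ≤ ‖y‖) (hfv : f v = lam) (hfz : 0 < f z)
    (hz : ∀ u, ‖u‖ = lam → (∀ w ∈ W, ‖u + w‖ ≤ lam) → (∃ w ∈ W, ‖u + w‖ = lam) → ‖u + z‖ ≤ lam)
    {w : E} (hw : w ∈ W) : ∃ m : ℝ, 0 < m ∧ w = (-m) • z := by
  have hfw : f w < 0 := by
    have := (hf (v + w)).trans_lt (hvW w hw)
    rw [map_add, hfv] at this
    linarith
  by_cases hd : (f z) • w + (-f w) • z = 0
  · refine ⟨-f w / f z, div_pos (neg_pos.2 hfw) hfz, ?_⟩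
    have h1 : (f z) • w = (f w) • z := by linear_combination (norm := module) hd
    rw [neg_div, neg_neg, div_eq_inv_mul, mul_smul, ← h1, smul_smul, inv_mul_cancel₀ hfz.ne',
      one_smul]
  exfalso
  -- A positive combination of `w` and `z` in the kernel of `f`: a functional norming an exit point
  -- on the side of `d` is nonpositive at `w` and `z`, hence at `d`.
  set d : E := (f z) • w + (-f w) • z with hdd
  have hfd : f d = 0 := by simp [hdd]; ring
  obtain ⟨e, he, -, hspan⟩ := exists_span_ker_of_finrank_eq_two hE f (v := v)
    (by rw [hfv]; exact hlam.ne')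
  obtain ⟨k, hk⟩ := hspan d hfd
  have hve : ∀ s t : ℝ, s • v + t • d = 0 → s = 0 ∧ t = 0 := by
    intro s t h
    have hs : s = 0 := by
      have := congrArg f h
      simpa [hfd, hfv, hlam.ne'] using this
    subst hs
    simpa [hd] using h
  obtain ⟨a, b, hb, hn, hle, hex⟩ := exists_first_exit hlam ⟨w, hw⟩ hv hvW hve
  have huz := hz _ hn hle hex
  have huw := hle w hw
  set u : E := a • v + b • d with hu
  obtain ⟨g, hgu, hg⟩ := exists_norming_functional (x := u) (norm_pos_iff.1 (hn ▸ hlam))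
  rw [hn] at hgu
  have hgz : g z ≤ 0 := by
    have := (hg (u + z)).trans huz
    rw [map_add, hgu] at this
    linarith
  have hgw : g w ≤ 0 := by
    have := (hg (u + w)).trans huw
    rw [map_add, hgu] at this
    linarith
  have hgd' : g d = f z * g w - f w * g z := by simp [hdd]; ring
  have hgd : g d ≤ 0 := by nlinarith
  have hgu' : a * g v + b * g d = lam := by rw [← hgu, hu]; simp
  have hfu : f u = a * lam := by rw [hu]; simp [hfv, hfd]
  have ha1 : a ≤ 1 := by
    have := hf u
    rw [hfu, hn] at this
    nlinarith
  have ha2 : -1 ≤ a := by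
    have := hf (-u)
    rw [map_neg, hfu, norm_neg, hn] at this
    nlinarith
  have hv1 : g v ≤ lam := hv ▸ hg v
  have hv2 : -lam ≤ g v := by
    have := hg (-v)
    rw [map_neg, norm_neg, hv] at this
    linarith
  -- With `|a| ≤ 1` and `|g v| ≤ lam`, the identity `a * g v + b * g d = lam` forces `g d = 0`.
  have hbd : b * g d ≤ 0 := mul_nonpos_of_nonneg_of_nonpos hb.le hgd
  have hav : lam ≤ a * g v := by linarith
  have hav' : a * g v ≤ lam := by
    have h1 : |a * g v| ≤ 1 * lam := by
      rw [abs_mul]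
      exact mul_le_mul (abs_le.2 ⟨ha2, ha1⟩) (abs_le.2 ⟨hv2, hv1⟩) (abs_nonneg _) zero_le_one
    linarith [le_abs_self (a * g v)]
  have hgd0 : g d = 0 := by
    have : b * g d = 0 := by linarith
    exact (mul_eq_zero.1 this).resolve_left hb.ne'
  have hgz0 : g z = 0 := by
    have h1 : f z * g w ≤ 0 := mul_nonpos_of_nonneg_of_nonpos hfz.le hgw
    have h2 : 0 ≤ f w * g z := mul_nonneg_of_nonpos_of_nonpos hfw.le hgz
    have h3 : f w * g z = 0 := by linarith
    exact (mul_eq_zero.1 h3).resolve_left hfw.ne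
  -- Now `g` vanishes on `d`, hence on the kernel of `f`, and at `z`, where `f` is positive; so `g v
  -- = 0`, against `lam ≤ a * g v`.
  obtain ⟨j, hj⟩ := hspan (lam • z - f z • v) (by simp [hfv]; ring)
  have hk0 : k ≠ 0 := by
    rintro rfl
    exact hd (by simpa using hk)
  have hge : g e = 0 := by
    rw [hk, map_smul, smul_eq_mul] at hgd0
    exact (mul_eq_zero.1 hgd0).resolve_left hk0
  have hgv : f z * g v = 0 := by
    have := congrArg g hj
    simp only [map_sub, map_smul, smul_eq_mul, hgz0, hge] at this
    linarith
  have := (mul_eq_zero.1 hgv).resolve_left hfz.ne'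
  rw [this] at hav
  linarith

/-- If every exit point stays in the disc after translation by `z`, then no supporting functional
at an inner point of the arc increases along `z`. -/
theorem not_exit_bound (hE : Module.finrank ℝ E = 2) {lam : ℝ} (hlam : 0 < lam)
    {v z : E} {W : Finset E} (hW : W.Nonempty) (hv : ‖v‖ = lam)
    (hvW : ∀ w ∈ W, ‖v + w‖ < lam)
    {f : E →L[ℝ] ℝ} (hf : ∀ y, f y ≤ ‖y‖) (hfv : f v = lam) (hfz : 0 < f z)
    (hz : ∀ u, ‖u‖ = lam → (∀ w ∈ W, ‖u + w‖ ≤ lam) → (∃ w ∈ W, ‖u + w‖ = lam) →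
      ‖u + z‖ ≤ lam) : False := by
  have hneg : ∀ w ∈ W, ∃ m : ℝ, 0 < m ∧ w = (-m) • z := fun w hw =>
    exists_neg_smul_of_exit_bound hE hlam hv hvW hf hfv hfz hz hw
  have hz0 : z ≠ 0 := by
    rintro rfl
    simp at hfz
  obtain ⟨e, he, hfe, -⟩ := exists_span_ker_of_finrank_eq_two hE f (v := v)
    (by rw [hfv]; exact hlam.ne')
  have hve : ∀ s t : ℝ, s • v + t • e = 0 → s = 0 ∧ t = 0 := by
    intro s t h
    have hs : s = 0 := by
      have := congrArg f h
      simpa [hfe, hfv, hlam.ne'] using this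
    subst hs
    simpa [he] using h
  obtain ⟨a, b, -, hn, hle, hex⟩ := exists_first_exit hlam hW hv hvW hve
  have huz := hz _ hn hle hex
  set u : E := a • v + b • e
  obtain ⟨g, hgu, hg⟩ := exists_norming_functional (x := u) (norm_pos_iff.1 (hn ▸ hlam))
  rw [hn] at hgu
  obtain ⟨w, hw⟩ := hW
  obtain ⟨m, hm, hwm⟩ := hneg w hw
  have hgz : g z = 0 := by
    have h1 := (hg (u + z)).trans huz
    have h2 := (hg (u + w)).trans (hle w hw)
    rw [hwm, map_add, map_smul, smul_eq_mul, hgu] at h2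
    rw [map_add, hgu] at h1
    nlinarith
  -- As `g z = 0`, the line through `u` along `z` supports the disc. Sliding `u` to the last disc
  -- point on it gives another exit point, which translation by `z` pushes out of the disc.
  set T : Set ℝ := {t | 0 ≤ t ∧ ‖u + t • z‖ ≤ lam} with hT
  have hTc : IsCompact T := by
    refine (isCompact_Icc (a := (0 : ℝ)) (b := 2 * lam / ‖z‖)).of_isClosed_subset ?_ ?_
    · exact (isClosed_le continuous_const continuous_id).inter
        (isClosed_le (f := fun t : ℝ => ‖u + t • z‖) (by fun_prop) continuous_const)
    · rintro t ⟨ht0, ht⟩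
      refine ⟨ht0, ?_⟩
      rw [le_div_iff₀ (norm_pos_iff.2 hz0)]
      have h1 : ‖(u + t • z) - u‖ ≤ ‖u + t • z‖ + ‖u‖ := norm_sub_le _ _
      rw [add_sub_cancel_left, norm_smul, Real.norm_of_nonneg ht0, hn] at h1
      linarith
  obtain ⟨t, ht, htmax⟩ := hTc.exists_isMaxOn ⟨0, le_rfl, by simpa using hn.le⟩
    continuousOn_id
  have hgt : ∀ s : ℝ, lam ≤ ‖u + s • z‖ := fun s => by
    have := hg (u + s • z)
    rwa [map_add, map_smul, hgz, smul_zero, add_zero, hgu] at this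
  have hseg : ∀ m : ℝ, 0 < m → ‖u + (-m) • z‖ ≤ lam → ‖u + (t - m) • z‖ ≤ lam := by
    intro m hm h1
    have hmt : 0 < m + t := by linarith [ht.1]
    have e1 : (m + t) • (u + (t - m) • z) = t • (u + t • z) + m • (u + (-m) • z) := by module
    have h2 := norm_add_le (t • (u + t • z)) (m • (u + (-m) • z))
    rw [← e1, norm_smul, norm_smul, norm_smul, Real.norm_of_nonneg hmt.le,
      Real.norm_of_nonneg ht.1, Real.norm_of_nonneg hm.le] at h2
    have h3 := mul_le_mul_of_nonneg_left ht.2 ht.1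
    have h4 := mul_le_mul_of_nonneg_left h1 hm.le
    refine le_of_mul_le_mul_left ?_ hmt
    linarith
  have hle' : ∀ w ∈ W, ‖u + t • z + w‖ = lam := by
    intro w hw
    obtain ⟨m, hm, hwm⟩ := hneg w hw
    have e1 : u + t • z + w = u + (t - m) • z := by rw [hwm]; module
    rw [e1]
    exact le_antisymm (hseg m hm (hwm ▸ hle w hw)) (hgt _)
  have h1 := hz (u + t • z) (le_antisymm ht.2 (hgt t)) (fun w hw => (hle' w hw).le)
    ⟨w, hw, hle' w hw⟩
  have h2 : t + 1 ∈ T := ⟨by linarith [ht.1], by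
    rw [add_smul, one_smul, ← add_assoc]
    exact h1⟩
  have h3 : t + 1 ≤ t := htmax h2
  linarith

/-- A disc containing all centers of discs with two points of `K` on the boundary contains all
centers of discs around `K`. Neither strict convexity nor a bound on the diameter of `K` is
needed. -/
theorem norm_sub_le_of_forall_arcDiscCenters (hE : Module.finrank ℝ E = 2) {K : Set E}
    (hfin : K.Finite) (hK : K.Nontrivial) {lam : ℝ} (hlam : 0 < lam) {y : E}
    (hy : ∀ x ∈ arcDiscCenters K lam, ‖x - y‖ ≤ lam) {c : E} (hc : ∀ k ∈ K, ‖c - k‖ ≤ lam) :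
    ‖c - y‖ ≤ lam := by
  by_contra! hlt
  obtain ⟨x, hx, hmax⟩ := (isCompact_ballCenters hE hK.nonempty lam).exists_isMaxOn ⟨c, hc⟩
    (f := fun x => ‖x - y‖) (by fun_prop)
  have hr : lam < ‖x - y‖ := hlt.trans_le (hmax hc)
  have hxH : x ∉ arcDiscCenters K lam := fun h => absurd (hy x h) (not_le.2 hr)
  have hxy : x - y ≠ 0 := norm_pos_iff.1 (hlam.trans hr)
  obtain ⟨f, hfx, hf⟩ := exists_norming_functional hxy
  -- moving a little from `x` within the active discs stays among the centers
  have hmove : ∀ b : E, (∀ k ∈ K, ‖x - k‖ = lam → ‖b - k‖ ≤ lam) → f b ≤ f x := by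
    intro b hb
    have hev : ∀ᶠ s in nhdsWithin (0 : ℝ) (Ioi 0), ∀ k ∈ K, ‖x + s • (b - x) - k‖ ≤ lam := by
      rw [Filter.eventually_all_finite hfin]
      intro k hk
      rcases eq_or_lt_of_le (hx k hk) with h | h
      · filter_upwards [Ioo_mem_nhdsGT (zero_lt_one' ℝ)] with s hs
        have e1 : x + s • (b - x) - k = (1 - s) • (x - k) + s • (b - k) := by module
        rw [e1]
        refine (norm_add_le _ _).trans ?_
        rw [norm_smul, norm_smul, Real.norm_of_nonneg hs.1.le,
          Real.norm_of_nonneg (by linarith [hs.2]), h]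
        nlinarith [hb k hk h, hs.1]
      · have hcont : Continuous fun s : ℝ => ‖x + s • (b - x) - k‖ := by fun_prop
        have := hcont.continuousAt.eventually_lt (x₀ := (0 : ℝ)) continuousAt_const
          (g := fun _ => lam) (by simpa using h)
        exact Filter.Eventually.filter_mono nhdsWithin_le_nhds (this.mono fun s hs => le_of_lt hs)
    obtain ⟨s, hs, hs0⟩ := (hev.and self_mem_nhdsWithin).exists
    have hs0 : 0 < s := hs0
    have h1 : ‖x + s • (b - x) - y‖ ≤ ‖x - y‖ := hmax hs
    have h2 := (hf _).trans h1
    rw [← hfx] at h2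
    simp only [map_sub, map_add, map_smul, smul_eq_mul] at h2
    nlinarith
  obtain ⟨p, hp, hxp⟩ : ∃ p ∈ K, ‖x - p‖ = lam := by
    by_contra! hno
    -- Without active discs every direction is allowed, and `f` grows along `x - y`.
    have := hmove (x + (x - y)) fun k hk h => absurd h (hno k hk)
    rw [map_add, hfx] at this
    linarith
  have huniq : ∀ q ∈ K, q ≠ p → ‖x - q‖ < lam := fun q hq hqp =>
    lt_of_le_of_ne (hx q hq) fun h =>
      hxH ((mem_arcDiscCenters_iff hE hlam).2 ⟨hx, q, hq, p, hp, hqp, h, hxp⟩)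
  have hfp : f (x - p) = lam := by
    refine le_antisymm (hxp ▸ hf _) ?_
    have hn : 0 < ‖x - y‖ := norm_pos_iff.2 hxy
    -- At this point of the disc around `p`, `f` attains its maximum `f p + lam`.
    have := hmove (p + (lam / ‖x - y‖) • (x - y)) fun k hk h => by
      have hkp : k = p := by
        by_contra hkp
        exact (huniq k hk hkp).ne h
      rw [hkp, add_sub_cancel_left, norm_smul_div_norm hlam hxy]
    rw [map_add, map_smul, hfx, smul_eq_mul, div_mul_cancel₀ _ hn.ne'] at this
    rw [map_sub]
    linarith
  classical
  -- With `p` as origin, a center `p + u` is within `lam` of `q` iff `‖u + (p - q)‖ ≤ lam`.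
  set W : Finset E := (hfin.toFinset.erase p).image fun q => p - q with hW
  have hmemW : ∀ q ∈ K, q ≠ p → p - q ∈ W := fun q hq hqp =>
    Finset.mem_image_of_mem _ (Finset.mem_erase.2 ⟨hqp, hfin.mem_toFinset.2 hq⟩)
  have hWmem : ∀ w ∈ W, ∃ q ∈ K, q ≠ p ∧ w = p - q := by
    intro w hw
    obtain ⟨q, hq, rfl⟩ := Finset.mem_image.1 hw
    obtain ⟨hqp, hq⟩ := Finset.mem_erase.1 hq
    exact ⟨q, hfin.mem_toFinset.1 hq, hqp, rfl⟩
  obtain ⟨q₀, hq₀, hq₀p⟩ := hK.exists_ne p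
  refine not_exit_bound hE hlam (v := x - p) (z := p - y) (W := W) ⟨_, hmemW q₀ hq₀ hq₀p⟩ hxp
    ?_ hf hfp ?_ ?_
  · intro w hw
    obtain ⟨q, hq, hqp, rfl⟩ := hWmem w hw
    rw [sub_add_sub_cancel]
    exact huniq q hq hqp
  · have h1 : f (p - y) = f (x - y) - f (x - p) := by simp only [map_sub]; ring
    rw [h1, hfx, hfp]
    linarith
  · rintro u hu hle ⟨w, hw, hwu⟩
    have e : ∀ q, u + (p - q) = u + p - q := fun q => by abel
    rw [e]
    refine hy _ ((mem_arcDiscCenters_iff hE hlam).2 ⟨fun k hk => ?_, ?_⟩)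
    · by_cases hkp : k = p
      · rw [hkp, add_sub_cancel_right, hu]
      · rw [← e]
        exact hle _ (hmemW k hk hkp)
    · obtain ⟨q, hq, hqp, rfl⟩ := hWmem w hw
      exact ⟨p, hp, q, hq, hqp.symm, by rw [add_sub_cancel_right, hu], by rw [← e, hwu]⟩

end NormedPlane

/-! ### The proposition. -/

theorem proposition3p8 {E : Type*} [NormedAddCommGroup E] [NormedSpace ℝ E]
    (hE : Module.finrank ℝ E = 2) (K : Set E) (hfin : K.Finite) (hK : K.Nontrivial)
    (lam : ℝ) (hpos : 0 < lam) (hcirc : circumradius K ≤ lam)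
    (h : StrictConvexSpace ℝ E ∨ Metric.diam K ≤ lam) :
    (ballHull K lam = ⋂ x ∈ arcDiscCenters K lam, Metric.closedBall x lam) ∧
    (∃ F : Finset E, (F : Set E) ⊆ arcDiscCenters K lam ∧
      ballHull K lam = ⋂ x ∈ F, Metric.closedBall x lam) := by
  have hsub : ∀ G ⊆ arcDiscCenters K lam,
      ballHull K lam ⊆ ⋂ x ∈ G, Metric.closedBall x lam := fun G hG =>
    biInter_subset_biInter_left fun x hx => (hG hx).1
  have hsup : (⋂ x ∈ arcDiscCenters K lam, Metric.closedBall x lam) ⊆ ballHull K lam := by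
    intro y hy
    refine mem_iInter₂.2 fun c hc => mem_closedBall_iff_norm'.2 ?_
    exact norm_sub_le_of_forall_arcDiscCenters hE hfin hK hpos
      (fun x hx => mem_closedBall_iff_norm'.1 (mem_iInter₂.1 hy x hx))
      fun k hk => mem_closedBall_iff_norm'.1 (hc hk)
  refine ⟨(hsub _ Subset.rfl).antisymm hsup, ?_⟩
  obtain ⟨F, hF, hFH, hHF⟩ := hasFiniteHull_arcDiscCenters hE hfin hK.nonempty hpos
  refine ⟨hF.toFinset, by simpa using hFH, Subset.antisymm ?_ ?_⟩
  · simpa using hsub F hFH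
  · refine Subset.trans (fun y hy => mem_iInter₂.2 fun x hx => ?_) hsup
    -- Exchange centers and points: the disc around `y` is convex and contains `F`, hence every arc
    -- disc center.
    have hconv : convexHull ℝ F ⊆ Metric.closedBall y lam :=
      convexHull_min (fun z hz => mem_closedBall_comm.1
        (mem_iInter₂.1 hy z (hF.mem_toFinset.2 hz))) (convex_closedBall y lam)
    exact mem_closedBall_comm.1 (hconv (hHF hx))
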